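/- A Berge cycle of length $k\ge 2$ in a hypergraph consists of $k$ distinct vertices $v_1,\dots,v_k$ and $k$ distinct edges $E_1,\dots,E_k$ with $\{v_i,v_{i+1}\}\subseteq E_i$ for all $i$, indices being read modulo $k$. For $g\ge 3$ let $\mathrm{ex}_r(N,\mathcal{C}_{<g})$ denote the maximum number of edges of an $r$-uniform hypergraph on $N$ vertices that contains no Berge cycle of length $k$ for any $2\le k\le g-1$. Theorem. For every integer $r\ge 2$ there are constants $c_r>0$ and $c_r'>0$, depending only on $r$, such that for all integers $N\ge r$: (a) $\mathrm{ex}_r(N,\mathcal{C}_{<5})\ge c_r\,N^{10/7}$, and (b) $\mathrm{ex}_r(N,\mathcal{C}_{<6})\ge c_r'\,N^{4/3}$. -/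

import Mathlib

namespace BergeTuran

/-- A hypergraph with vertex set `V` is given by its set `H` of edges; it is `r`-uniform if
`H ⊆ (V choose r)`, i.e. if every edge has exactly `r` elements. -/
def IsUniform {V : Type*} (r : ℕ) (H : Finset (Finset V)) : Prop :=
  ∀ e ∈ H, e.card = r

/-- `H` contains a Berge cycle of length `k`: `k` distinct vertices `v i` and `k` distinct edges
`E i` of `H` with `{v i, v (i + 1)} ⊆ E i`, the indices being read modulo `k`.
Only used for `2 ≤ k`. -/
def HasBergeCycle {V : Type*} (H : Finset (Finset V)) (k : ℕ) : Prop :=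
  ∃ (v : ZMod k → V) (E : ZMod k → Finset V),
    Function.Injective v ∧ Function.Injective E ∧
      ∀ i : ZMod k, E i ∈ H ∧ v i ∈ E i ∧ v (i + 1) ∈ E i

/-- `H` is `𝒞_{<g}`-free (has girth at least `g`): it contains no Berge cycle of any
length `k` with `2 ≤ k ≤ g - 1`. -/
def IsBergeCycleFree {V : Type*} (g : ℕ) (H : Finset (Finset V)) : Prop :=
  ∀ k : ℕ, 2 ≤ k → k < g → ¬ HasBergeCycle H k

open scoped Classical in
/-- The Turán number `ex_r(N, 𝒞_{<g})`: the maximum number of edges of a `𝒞_{<g}`-free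
`r`-uniform hypergraph on `N` vertices. -/
noncomputable def exBerge (r N g : ℕ) : ℕ :=
  (Finset.univ.filter fun H : Finset (Finset (Fin N)) =>
    IsUniform r H ∧ IsBergeCycleFree g H).sup Finset.card

end BergeTuran

/-!
Take the lines of a vector space `G` over `K` whose direction lies in a fixed family `f`, and
record each of them by its points at `r` parameters `a i`, the `i`-th point in the `i`-th copy of
`G`. A Berge cycle then becomes a closed polygon, with sides `(a j - a i) • f h` and consecutive
`h` distinct. If any `m` members of `f` are affinely independent, a polygon with at most `m` sides
closes up only when the coefficients cancel within each direction, so that every direction occurs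
at least twice. For `m ≤ 5` only parallelograms survive, and these are excluded by choosing the
parameters to be a Sidon set.

For `m = 4` the directions are `(t, t ^ 2, N t)`, with `t` in the cubic extension of `𝔽_q` and `N`
its norm. An affine dependence of four of them would make the four values of `t` collinear over
`𝔽_q`, and on a line `N` is a cubic polynomial, so Vandermonde applies. This gives `q ^ 10` edges on
`r * q ^ 7` vertices.

For `m = 5` the directions are the `x ∈ 𝔽_{q ^ 6}` with `x ^ (q ^ 2 - q + 1) = 1`. An affine
dependence is preserved by the Frobenius map `φ`, whose orbit of `x` is `x`, `φ x`, `φ x / x` and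
their inverses. It therefore annihilates every product of a linear form in `1, x, φ x` with one in
`1, x⁻¹, (φ x)⁻¹`. As no three points `(x, φ x)` are collinear, such a product can be chosen to
vanish at any four of the five points and not at the fifth. This gives about `q ^ 8` edges on
`r * q ^ 6` vertices.

Bertrand's postulate provides a suitable prime `q` for each number of vertices.
-/

namespace BergeTuran

open Finset

section Hypergraph

variable {V W : Type*}

theorem HasBergeCycle.of_map (φ : V ↪ W) {H : Finset (Finset V)} {k : ℕ}
    (h : HasBergeCycle (H.map (mapEmbedding φ).toEmbedding) k) : HasBergeCycle H k := by
  obtain ⟨v, E, hv, hE, hvE⟩ := h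
  have exists_edge (i) : ∃ e ∈ H, e.map φ = E i := by simpa using (hvE i).1
  choose e heH he using exists_edge
  have exists_vertex (i) : ∃ x ∈ e i, φ x = v i := by
    simpa [← he i] using (hvE i).2.1
  choose x hxe hx using exists_vertex
  refine ⟨x, e, fun i j hij => hv ?_, fun i j hij => hE ?_, fun i => ⟨heH i, hxe i, ?_⟩⟩
  · rw [← hx, ← hx, hij]
  · rw [← he, ← he, hij]
  · simpa [← he i, ← hx (i + 1)] using (hvE i).2.2

theorem isBergeCycleFree_singleton (g : ℕ) (e : Finset V) : IsBergeCycleFree g {e} := by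
  rintro k hk - ⟨v, E, -, hE, h⟩
  have : Fact (1 < k) := ⟨hk⟩
  have h01 : E 0 = E 1 := (mem_singleton.1 (h 0).1).trans (mem_singleton.1 (h 1).1).symm
  exact zero_ne_one (hE h01)

theorem card_le_exBerge [Finite V] {r N g : ℕ} (hV : Nat.card V ≤ N) {H : Finset (Finset V)}
    (hu : IsUniform r H) (hf : IsBergeCycleFree g H) : #H ≤ exBerge r N g := by
  classical
  cases nonempty_fintype V
  obtain ⟨φ⟩ : Nonempty (V ↪ Fin N) :=
    Function.Embedding.nonempty_of_card_le (by simpa [Nat.card_eq_fintype_card] using hV)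
  rw [← card_map (mapEmbedding φ).toEmbedding, exBerge]
  refine le_sup (f := card) (mem_filter.2 ⟨mem_univ _, ?_, fun k hk hkg hc => ?_⟩)
  · intro e he
    obtain ⟨e', he', rfl⟩ := mem_map.1 he
    simpa using hu e' he'
  · exact hf k hk hkg (hc.of_map φ)

theorem one_le_exBerge {r N : ℕ} (hN : r ≤ N) (g : ℕ) : 1 ≤ exBerge r N g := by
  have hu : IsUniform r {univ.map (Fin.castLEEmb hN)} := by simp [IsUniform]
  simpa using card_le_exBerge (Nat.card_fin N).le hu (isBergeCycleFree_singleton g _)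

end Hypergraph

section AffineIndependence

variable {ι K G : Type*} [Field K] [AddCommGroup G] [Module K G] {f : ι → G} {m : ℕ}

theorem affineIndependent_finset_iff {T : Finset ι} :
    AffineIndependent K (fun i : T => f i) ↔
      ∀ c : ι → K, ∑ i ∈ T, c i = 0 → ∑ i ∈ T, c i • f i = 0 → ∀ i ∈ T, c i = 0 := by
  classical
  constructor
  · intro h c hc hcf i hi
    exact affineIndependent_iff.1 h univ (fun i => c i) (by rwa [sum_coe_sort T c])
      (by rwa [sum_coe_sort T fun i => c i • f i]) ⟨i, hi⟩ (mem_univ _)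
  · intro h
    rw [affineIndependent_iff_of_fintype]
    intro w hw hwf i
    rw [univ.weightedVSub_eq_linear_combination hw] at hwf
    have key := h (fun j => if hj : j ∈ T then w ⟨j, hj⟩ else 0)
      (by rw [← sum_coe_sort]; simpa using hw) (by rw [← sum_coe_sort]; simpa using hwf) i i.2
    simpa using key

variable (K) in
/-- `m`-wise affine independence: any `m` of the points `f i` are affinely independent. Allowing
fewer than `m` points makes the notion meaningful for families with fewer than `m` members. -/
def AffineIndependentUpTo (m : ℕ) (f : ι → G) : Prop :=
  ∀ T : Finset ι, #T ≤ m → AffineIndependent K fun i : T => f i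

theorem AffineIndependentUpTo.injective (hf : AffineIndependentUpTo K m f) (hm : 2 ≤ m) :
    Function.Injective f := by
  classical
  intro i j hij
  have := (hf {i, j} (card_le_two.trans hm)).injective
    (a₁ := ⟨i, by simp⟩) (a₂ := ⟨j, by simp⟩) hij
  simpa using this

theorem affineIndependentUpTo_of_card_eq [Finite ι] (hm : m ≤ Nat.card ι)
    (h : ∀ T : Finset ι, #T = m → AffineIndependent K fun i : T => f i) :
    AffineIndependentUpTo K m f := by
  cases nonempty_fintype ι
  intro T hT
  obtain ⟨T', hTT', hT'⟩ := exists_superset_card_eq hT (by rwa [← Nat.card_eq_fintype_card])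
  exact (h T' hT').comp_embedding (Set.embeddingOfSubset _ _ hTT')

theorem AffineIndependentUpTo.sum_fiber_eq_zero [DecidableEq ι] (hf : AffineIndependentUpTo K m f)
    {β : Type*} [Fintype β] (hβ : Fintype.card β ≤ m) {d : β → K} {h : β → ι}
    (hd : ∑ b, d b = 0) (hdf : ∑ b, d b • f (h b) = 0) (b : β) :
    ∑ b' with h b' = h b, d b' = 0 := by
  have maps_to : ∀ b ∈ univ, h b ∈ univ.image h := fun b _ => mem_image_of_mem h (mem_univ b)
  refine affineIndependent_finset_iff.1 (hf (univ.image h) (card_image_le.trans hβ))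
    (fun i => ∑ b' with h b' = i, d b') ?_ ?_ (h b) (maps_to b (mem_univ b))
  · rwa [sum_fiberwise_of_maps_to maps_to]
  · calc ∑ i ∈ univ.image h, (∑ b' with h b' = i, d b') • f i
        = ∑ i ∈ univ.image h, ∑ b' with h b' = i, d b' • f (h b') :=
          sum_congr rfl fun i _ => by
            rw [sum_smul]
            exact sum_congr rfl fun b' hb' => by rw [(mem_filter.1 hb').2]
      _ = ∑ b', d b' • f (h b') := sum_fiberwise_of_maps_to maps_to _
      _ = 0 := hdf

end AffineIndependence

section Sidon

/-- Sidon sets, as injectively indexed families: the sums of two terms are distinct up to order.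
With `j = k` the condition contains the injectivity of `a`, from which the equality of the other
two indices follows. -/
def IsSidon {κ A : Type*} [Add A] (a : κ → A) : Prop :=
  ∀ i j k l, a i + a k = a j + a l → i = j ∨ i = l

theorem IsSidon.injective {κ A : Type*} [Add A] {a : κ → A} (ha : IsSidon a) :
    Function.Injective a := fun i j h => by
  simpa using ha i j j j (by rw [h])

theorem IsSidon.natCast_zmod {κ : Type*} {a : κ → ℕ} (ha : IsSidon a) {p : ℕ}
    (hp : ∀ i, 2 * a i < p) : IsSidon fun i => (a i : ZMod p) := by
  intro i j k l h
  have := hp i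
  have := hp j
  have := hp k
  have := hp l
  have hmod : (a i + a k) % p = (a j + a l) % p := by
    rw [← ZMod.natCast_eq_natCast_iff', Nat.cast_add, Nat.cast_add]
    exact h
  rw [Nat.mod_eq_of_lt (by lia), Nat.mod_eq_of_lt (by lia)] at hmod
  exact ha i j k l hmod

-- Modulo `2 * r` one reads off the sum of two indices, and then the sum of their squares.
theorem isSidon_add_mul_sq (r : ℕ) : IsSidon fun i : Fin r => (i + 2 * r * i ^ 2 : ℕ) := by
  intro i j k l h
  beta_reduce at h
  have hi := i.2
  have hj := j.2
  have hk := k.2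
  have hl := l.2
  rw [Fin.ext_iff, Fin.ext_iff]
  generalize (i : ℕ) = i, (j : ℕ) = j, (k : ℕ) = k, (l : ℕ) = l at *
  have h' : (i + k) + 2 * r * (i ^ 2 + k ^ 2) = (j + l) + 2 * r * (j ^ 2 + l ^ 2) := by
    linarith
  have sum_eq : i + k = j + l := by
    have hmod := congrArg (· % (2 * r)) h'
    simpa only [Nat.add_mul_mod_self_left, Nat.mod_eq_of_lt (show i + k < 2 * r by lia),
      Nat.mod_eq_of_lt (show j + l < 2 * r by lia)] using hmod
  have sq_eq : i ^ 2 + k ^ 2 = j ^ 2 + l ^ 2 :=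
    Nat.eq_of_mul_eq_mul_left (show 0 < 2 * r by lia) (by linarith)
  zify at sum_eq sq_eq ⊢
  have factored : 2 * (((i : ℤ) - j) * (i - l)) = 0 := by
    linear_combination sq_eq - (k + (j + l - i)) * sum_eq
  simpa [sub_eq_zero] using factored

theorem exists_isSidon_zmod (r : ℕ) :
    ∃ M : ℕ, ∀ p, M < p → ∃ a : Fin r → ZMod p, IsSidon a := by
  refine ⟨2 * (r + 2 * r * r ^ 2), fun p hp =>
    ⟨_, (isSidon_add_mul_sq r).natCast_zmod fun i => lt_of_le_of_lt ?_ hp⟩⟩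
  have := i.2.le
  gcongr

end Sidon

section Cycle

variable {ι : Type*}

-- Two indices with equal values are at distance at least `2` on the cycle.
theorem eq_four_of_repetition {k : ℕ} (hk : 2 ≤ k) (hk' : k ≤ 5) {h : ZMod k → ι}
    (hadj : ∀ j, h j ≠ h (j + 1)) (hrep : ∀ j, ∃ j', j' ≠ j ∧ h j' = h j) : k = 4 := by
  have apart (j) : ∃ j', j' ≠ j ∧ j' ≠ j + 1 ∧ j ≠ j' + 1 ∧ h j' = h j := by
    obtain ⟨j', hne, heq⟩ := hrep j
    refine ⟨j', hne, ?_, ?_, heq⟩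
    · rintro rfl
      exact hadj j heq.symm
    · rintro rfl
      exact hadj j' heq
  interval_cases k
  · obtain ⟨j', h₀, h₁, -⟩ := apart 0
    revert j'
    decide
  · obtain ⟨j', h₀, h₁, h₂, -⟩ := apart 0
    revert j'
    decide
  · rfl
  · have opposite (j : ZMod 5) : h (j + 2) = h j ∨ h (j + 3) = h j := by
      obtain ⟨j', h₀, h₁, h₂, heq⟩ := apart j
      have : j' = j + 2 ∨ j' = j + 3 := by
        clear heq
        revert j j'
        decide
      rcases this with rfl | rfl
      · exact Or.inl heq
      · exact Or.inr heq
    have o₀ : h 2 = h 0 ∨ h 3 = h 0 := opposite 0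
    have o₁ : h 3 = h 1 ∨ h 4 = h 1 := opposite 1
    have o₂ : h 4 = h 2 ∨ h 0 = h 2 := opposite 2
    have o₃ : h 0 = h 3 ∨ h 1 = h 3 := opposite 3
    have o₄ : h 1 = h 4 ∨ h 2 = h 4 := opposite 4
    have a₀ : h 0 ≠ h 1 := hadj 0
    have a₁ : h 1 ≠ h 2 := hadj 1
    have a₂ : h 2 ≠ h 3 := hadj 2
    have a₃ : h 3 ≠ h 4 := hadj 3
    have a₄ : h 4 ≠ h 0 := hadj 4
    grind

theorem filter_eq_zero_two_of_repetition [DecidableEq ι] {h : ZMod 4 → ι}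
    (hadj : ∀ j, h j ≠ h (j + 1)) (hrep : ∃ j, j ≠ 0 ∧ h j = h 0) :
    (univ.filter fun j => h j = h 0) = {0, 2} := by
  have a₁ : h 1 ≠ h 0 := (hadj 0).symm
  have a₃ : h 3 ≠ h 0 := hadj 3
  have cases4 : ∀ j : ZMod 4, j = 0 ∨ j = 1 ∨ j = 2 ∨ j = 3 := by decide
  have h₂ : h 2 = h 0 := by
    obtain ⟨j, hj, heq⟩ := hrep
    rcases cases4 j with rfl | rfl | rfl | rfl
    exacts [absurd rfl hj, absurd heq a₁, heq, absurd heq a₃]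
  have ne₁ : (1 : ZMod 4) ∉ ({0, 2} : Finset (ZMod 4)) := by decide
  have ne₃ : (3 : ZMod 4) ∉ ({0, 2} : Finset (ZMod 4)) := by decide
  ext j
  rcases cases4 j with rfl | rfl | rfl | rfl
  · simp
  · simp only [mem_filter_univ, a₁, ne₁]
  · simp [h₂]
  · simp only [mem_filter_univ, a₃, ne₃]

theorem sum_add_one_sub_eq_zero {A : Type*} [AddCommGroup A] {k : ℕ} [NeZero k] (s : ZMod k → A) :
    ∑ j, (s (j + 1) - s j) = 0 := by
  rw [sum_sub_distrib, sub_eq_zero]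
  exact Equiv.sum_comp (Equiv.addRight 1) s

end Cycle

section LineHypergraph

variable {ι κ K G : Type*} [Field K] [AddCommGroup G] [Module K G]

section SampledLine

variable [Fintype κ]

/-- The line through `x` with direction `v`, sampled at the parameters `a i`. The `i`-th sample is
put into the `i`-th of `κ` disjoint copies of `G`. -/
def sampledLine (a : κ → K) (x v : G) : Finset (κ × G) :=
  univ.map ⟨fun i => (i, x + a i • v), fun _ _ h => congrArg Prod.fst h⟩

variable {a : κ → K} {x y v w : G}

theorem mem_sampledLine {z : κ × G} : z ∈ sampledLine a x v ↔ z.2 = x + a z.1 • v := by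
  refine ⟨fun h => ?_, fun h => mem_map.2 ⟨z.1, mem_univ _, Prod.ext rfl h.symm⟩⟩
  obtain ⟨i, -, rfl⟩ := mem_map.1 h
  rfl

theorem card_sampledLine : #(sampledLine a x v) = Fintype.card κ :=
  card_map _

theorem sampledLine_inj [Nontrivial κ] (ha : Function.Injective a) :
    sampledLine a x v = sampledLine a y w ↔ x = y ∧ v = w := by
  refine ⟨fun h => ?_, fun ⟨hxy, hvw⟩ => by rw [hxy, hvw]⟩
  have agree (i) : x + a i • v = y + a i • w :=
    mem_sampledLine.1 (h ▸ mem_sampledLine.2 rfl : (i, x + a i • v) ∈ sampledLine a y w)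
  obtain ⟨i, j, hij⟩ := exists_pair_ne κ
  have smul_sub : (a i - a j) • (v - w) = 0 := by
    linear_combination (norm := module) agree i - agree j
  obtain rfl : v = w := sub_eq_zero.1
    ((smul_eq_zero.1 smul_sub).resolve_left (sub_ne_zero.2 (ha.ne hij)))
  exact ⟨add_right_cancel (agree i), rfl⟩

end SampledLine

variable [Fintype κ] [Fintype ι] [Fintype G] {a : κ → K} {f : ι → G}

open scoped Classical in
/-- The hypergraph of all lines of `G` whose direction is one of the vectors `f i`, each line being
sampled at the parameters `a`. -/
noncomputable def lineHypergraph (a : κ → K) (f : ι → G) : Finset (Finset (κ × G)) :=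
  univ.image fun q : G × ι => sampledLine a q.1 (f q.2)

theorem isUniform_lineHypergraph : IsUniform (Fintype.card κ) (lineHypergraph a f) := by
  classical
  intro e he
  obtain ⟨q, -, rfl⟩ := mem_image.1 he
  exact card_sampledLine

theorem card_lineHypergraph [Nontrivial κ] (ha : Function.Injective a)
    (hf : Function.Injective f) :
    #(lineHypergraph a f) = Fintype.card G * Fintype.card ι := by
  classical
  rw [lineHypergraph, card_image_of_injective _ ?_, card_univ, Fintype.card_prod]
  intro q q' h
  obtain ⟨h₁, h₂⟩ := (sampledLine_inj ha).1 h
  exact Prod.ext h₁ (hf h₂)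

theorem HasBergeCycle.exists_closed_polygon {k : ℕ} [NeZero k] (hk : 2 ≤ k)
    (hc : HasBergeCycle (lineHypergraph a f) k) :
    ∃ (p : ZMod k → κ) (h : ZMod k → ι), (∀ j, p j ≠ p (j + 1)) ∧ (∀ j, h j ≠ h (j + 1)) ∧
      ∑ j, (a (p (j + 1)) - a (p j)) • f (h j) = 0 := by
  obtain ⟨v, E, hv, hE, hvE⟩ := hc
  have : Fact (1 < k) := ⟨hk⟩
  have exists_line (j) : ∃ q : G × ι, sampledLine a q.1 (f q.2) = E j := by
    simpa [lineHypergraph] using (hvE j).1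
  choose q hq using exists_line
  have start (j) : (v j).2 = (q j).1 + a (v j).1 • f (q j).2 :=
    mem_sampledLine.1 (hq j ▸ (hvE j).2.1)
  have finish (j) : (v (j + 1)).2 = (q j).1 + a (v (j + 1)).1 • f (q j).2 :=
    mem_sampledLine.1 (hq j ▸ (hvE j).2.2)
  refine ⟨fun j => (v j).1, fun j => (q j).2, fun j (hj : (v j).1 = _) => ?_,
    fun j (hj : (q j).2 = _) => ?_, ?_⟩
  · have : v j = v (j + 1) := Prod.ext hj (by rw [start, finish, hj])
    simpa using hv this
  · have base_eq : (q j).1 = (q (j + 1)).1 := by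
      have := (finish j).symm.trans (start (j + 1))
      rw [hj] at this
      exact add_right_cancel this
    have : E j = E (j + 1) := by rw [← hq, ← hq, base_eq, hj]
    simpa using hE this
  · rw [← sum_add_one_sub_eq_zero fun j => (v j).2]
    refine sum_congr rfl fun j _ => ?_
    rw [start j, finish j, sub_smul]
    abel

/-- The steps in a common direction cancel, so that no direction occurs only once. This leaves
parallelograms, which a Sidon family excludes. -/
theorem isBergeCycleFree_lineHypergraph {m : ℕ} (hm : m ≤ 5) (ha : IsSidon a)
    (hf : AffineIndependentUpTo K m f) : IsBergeCycleFree (m + 1) (lineHypergraph a f) := by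
  classical
  intro k hk hkm hc
  have : NeZero k := ⟨by lia⟩
  obtain ⟨p, h, hp, hh, hsum⟩ := hc.exists_closed_polygon hk
  set d : ZMod k → K := fun j => a (p (j + 1)) - a (p j) with hd
  have d_ne_zero (j) : d j ≠ 0 := sub_ne_zero.2 (ha.injective.ne (hp j).symm)
  have fiber_sum (j) : ∑ j' with h j' = h j, d j' = 0 :=
    hf.sum_fiber_eq_zero (by rw [ZMod.card]; lia)
      (sum_add_one_sub_eq_zero fun j => a (p j)) hsum j
  have repetition (j) : ∃ j', j' ≠ j ∧ h j' = h j := by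
    by_contra! hj
    have fiber_eq : (univ.filter fun j' => h j' = h j) = {j} := by
      ext j'
      simpa using ⟨fun e => by_contra fun hne => hj j' hne e, fun e => congrArg h e⟩
    exact d_ne_zero j (by simpa [fiber_eq] using fiber_sum j)
  obtain rfl := eq_four_of_repetition hk (by lia) hh repetition
  have parallelogram : d 0 + d 2 = 0 := by
    have := fiber_sum 0
    rwa [filter_eq_zero_two_of_repetition hh (repetition 0), sum_pair (by decide)] at this
  have sidon_relation : a (p 1) + a (p 3) = a (p 0) + a (p 2) := by
    have d₀ : d 0 = a (p 1) - a (p 0) := rfl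
    have d₂ : d 2 = a (p 3) - a (p 2) := rfl
    linear_combination parallelogram - d₀ - d₂
  rcases ha _ _ _ _ sidon_relation with e | e
  · exact hp 0 e.symm
  · exact hp 1 e

omit [Fintype κ] [Fintype ι] [Fintype G] in
theorem natCard_mul_natCard_le_exBerge [Finite G] [Finite ι] {r m N : ℕ} (hr : 2 ≤ r)
    (hm : 2 ≤ m) (hm' : m ≤ 5) {a : Fin r → K} (ha : IsSidon a)
    (hf : AffineIndependentUpTo K m f) (hN : r * Nat.card G ≤ N) :
    Nat.card G * Nat.card ι ≤ exBerge r N (m + 1) := by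
  cases nonempty_fintype G
  cases nonempty_fintype ι
  have : Nontrivial (Fin r) := Fin.nontrivial_iff_two_le.2 hr
  rw [Nat.card_eq_fintype_card, Nat.card_eq_fintype_card,
    ← card_lineHypergraph ha.injective (hf.injective hm)]
  refine card_le_exBerge (by simpa using hN) ?_ (isBergeCycleFree_lineHypergraph hm' ha hf)
  simpa using isUniform_lineHypergraph (a := a) (f := f)

end LineHypergraph

section Moments

open Polynomial

variable {ι K L : Type*} [Field K] [Field L] [Algebra K L]
variable {T : Finset ι} {c : ι → K} {x : ι → L}

theorem sum_filter_ne_zero_smul [DecidableEq K] {A : Type*} [AddCommGroup A] [Module K A]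
    (f : ι → A) : ∑ i ∈ T with c i ≠ 0, c i • f i = ∑ i ∈ T, c i • f i :=
  sum_filter_of_ne fun i _ h h₀ => h (by rw [h₀, zero_smul])

theorem sum_smul_eval_eq_zero {n : ℕ} (h : ∀ j < n, ∑ i ∈ T, c i • x i ^ j = 0) {P : L[X]}
    (hP : P.degree < n) : ∑ i ∈ T, c i • P.eval (x i) = 0 := by
  rcases eq_or_ne P 0 with rfl | hP₀
  · simp
  simp only [eval_eq_sum_range' ((natDegree_lt_iff_degree_lt hP₀).2 hP), smul_sum,
    ← mul_smul_comm]
  rw [sum_comm]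
  refine sum_eq_zero fun j hj => ?_
  rw [← mul_sum, h j (mem_range.1 hj), mul_zero]

theorem eq_zero_of_sum_smul_pow_eq_zero (hx : Set.InjOn x T)
    (h : ∀ j < #T, ∑ i ∈ T, c i • x i ^ j = 0) : ∀ i ∈ T, c i = 0 := by
  classical
  intro i hi
  have hdeg : (Lagrange.basis T x i).degree < #T := by
    rw [Lagrange.degree_basis hx hi]
    exact_mod_cast Nat.sub_lt (card_pos.2 ⟨i, hi⟩) one_pos
  have key := sum_smul_eval_eq_zero h hdeg
  rw [sum_eq_single_of_mem i hi fun j hj hji => by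
    rw [Lagrange.eval_basis_of_ne hji.symm hj, smul_zero], Lagrange.eval_basis_self hx hi] at key
  exact (smul_eq_zero.1 key).resolve_right one_ne_zero

end Moments

section NormCurve

open Polynomial

variable {K L : Type*} [Field K] [Field L] [Algebra K L] {T : Finset L} {c : L → K}

theorem exists_monic_norm_smul_add_eq_eval [FiniteDimensional K L] {u : L} (hu : u ≠ 0) (t₀ : L) :
    ∃ χ : K[X], χ.Monic ∧ χ.natDegree = Module.finrank K L ∧
      ∀ x : K, Algebra.norm K (x • u + t₀) = Algebra.norm K u * χ.eval x := by
  refine ⟨(Algebra.lmul K L (-t₀ / u)).charpoly, LinearMap.charpoly_monic _,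
    LinearMap.charpoly_natDegree _, fun x => ?_⟩
  have factored : x • u + t₀ = u * (algebraMap K L x - -t₀ / u) := by
    rw [Algebra.smul_def]
    field_simp
    ring
  rw [factored, map_mul, LinearMap.eval_charpoly, Algebra.norm_apply K (_ - _)]
  congr 2
  ext y
  simp [Algebra.smul_def]

theorem exists_ne_zero_forall_eq_smul_add_of_collinear {s : Set L} (hs : Collinear K s) :
    ∃ u t₀ : L, u ≠ 0 ∧ ∀ t ∈ s, ∃ x : K, t = x • u + t₀ := by
  obtain ⟨t₀, u, hu⟩ := (collinear_iff_exists_forall_eq_smul_vadd s).1 hs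
  rcases eq_or_ne u 0 with rfl | hu₀
  · exact ⟨1, t₀, one_ne_zero, fun t ht => ⟨0, by simpa using hu t ht⟩⟩
  · exact ⟨u, t₀, hu₀, hu⟩

-- On a `K`-line the norm restricts to a polynomial of degree exactly `[L : K]`, so that its sum
-- supplies the one power sum missing for Vandermonde.
theorem eq_zero_of_collinear_of_sum_smul_norm_eq_zero [FiniteDimensional K L]
    (hT : #T ≤ Module.finrank K L + 1) (hcol : Collinear K (T : Set L))
    (hpow : ∀ j < Module.finrank K L, ∑ t ∈ T, c t • t ^ j = 0)
    (hnorm : ∑ t ∈ T, c t • Algebra.norm K t = 0) : ∀ t ∈ T, c t = 0 := by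
  obtain ⟨u, t₀, hu, hx⟩ := exists_ne_zero_forall_eq_smul_add_of_collinear hcol
  choose! x hx using hx
  have x_injOn : Set.InjOn x T := fun s hs t ht hst => by rw [hx s hs, hx t ht, hst]
  have low_moments (j) (hj : j < Module.finrank K L) : ∑ t ∈ T, c t • x t ^ j = 0 := by
    have hdeg : (((X - C t₀) * C u⁻¹) ^ j).degree < (Module.finrank K L : WithBot ℕ) := by
      rw [degree_pow, degree_mul, degree_X_sub_C, degree_C (inv_ne_zero hu)]
      simpa using hj
    apply (algebraMap K L).injective
    rw [map_zero, ← sum_smul_eval_eq_zero hpow hdeg, map_sum]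
    refine sum_congr rfl fun t ht => ?_
    have : (t - t₀) * u⁻¹ = algebraMap K L (x t) := by
      rw [mul_inv_eq_iff_eq_mul₀ hu, sub_eq_iff_eq_add, ← Algebra.smul_def]
      exact hx t ht
    simp [this, Algebra.smul_def]
  obtain ⟨χ, hχ, hχdeg, hχeval⟩ := exists_monic_norm_smul_add_eq_eval (K := K) hu t₀
  have sum_charpoly : ∑ t ∈ T, c t • χ.eval (x t) = 0 := by
    refine (mul_eq_zero.1 ?_).resolve_left (Algebra.norm_ne_zero_iff.2 hu)
    rw [← hnorm, mul_sum]
    refine sum_congr rfl fun t ht => ?_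
    rw [mul_smul_comm, ← hχeval, ← hx t ht]
  have top_moment : ∑ t ∈ T, c t • x t ^ Module.finrank K L = 0 := by
    have hdeg : (χ - X ^ Module.finrank K L).degree < (Module.finrank K L : WithBot ℕ) := by
      have hχ' : χ.degree = Module.finrank K L := by rw [degree_eq_natDegree hχ.ne_zero, hχdeg]
      rw [← hχ']
      exact degree_sub_lt_left (by rw [hχ', degree_X_pow]) hχ.ne_zero
        (by rw [hχ.leadingCoeff, leadingCoeff_X_pow])
    have key := sum_smul_eval_eq_zero low_moments hdeg
    simpa [smul_sub, sum_sub_distrib, sum_charpoly, -smul_eq_mul] using key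
  refine eq_zero_of_sum_smul_pow_eq_zero x_injOn fun j hj => ?_
  rcases (show j ≤ Module.finrank K L by lia).lt_or_eq with hlt | rfl
  exacts [low_moments j hlt, top_moment]

theorem mem_range_algebraMap_of_natDegree_le_two (hL : Odd (Module.finrank K L)) {x : L}
    {P : K[X]} (hP : P ≠ 0) (hdeg : P.natDegree ≤ 2) (hx : aeval x P = 0) :
    x ∈ (algebraMap K L).range := by
  have : FiniteDimensional K L := Module.finite_of_finrank_pos hL.pos
  have hint : IsIntegral K x := Algebra.IsIntegral.isIntegral x
  have le_two : (minpoly K x).natDegree ≤ 2 :=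
    (natDegree_le_of_dvd (minpoly.dvd K x hx) hP).trans hdeg
  have odd_degree : Odd (minpoly K x).natDegree := hL.of_dvd_nat (minpoly.degree_dvd hint)
  rw [← minpoly.natDegree_eq_one_iff]
  obtain ⟨m, hm⟩ := odd_degree
  lia

-- Eliminating `y` leaves a quadratic equation for `x`.
theorem mem_range_algebraMap_of_power_sums (hL : Odd (Module.finrank K L)) (h2 : (2 : K) ≠ 0)
    {a b d : K} (ha : a ≠ 0) (hb : b ≠ 0) {x y : L} (h₁ : a • x + b • 1 + d • y = 0)
    (h₂ : a • x ^ 2 + b • 1 + d • y ^ 2 = 0) : x ∈ (algebraMap K L).range := by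
  set P : K[X] := C (a * (d + a)) * X ^ 2 + C (2 * a * b) * X + C (b * (d + b)) with hP
  refine mem_range_algebraMap_of_natDegree_le_two hL (P := P) (fun h₀ => ?_)
    natDegree_quadratic_le ?_
  · have coeff_one : P.coeff 1 = 2 * a * b := by
      simp [hP, coeff_X_pow, coeff_C, -map_mul, -map_add]
    rw [h₀, coeff_zero] at coeff_one
    exact mul_ne_zero (mul_ne_zero h2 ha) hb coeff_one.symm
  · simp only [Algebra.smul_def, mul_one] at h₁ h₂
    simp only [hP, map_add, map_mul, map_pow, map_ofNat, aeval_C, aeval_X]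
    linear_combination algebraMap K L d * h₂ +
      (algebraMap K L a * x + algebraMap K L b - algebraMap K L d * y) * h₁

theorem collinear_of_power_sums (hL : Odd (Module.finrank K L)) (h2 : (2 : K) ≠ 0) (hT : #T = 4)
    (hc : ∀ t ∈ T, c t ≠ 0) (hpow : ∀ j < 3, ∑ t ∈ T, c t • t ^ j = 0) :
    Collinear K (T : Set L) := by
  classical
  obtain ⟨p, q, r, s, hpq, hpr, hps, hqr, hqs, hrs, rfl⟩ := card_eq_four.1 hT
  have hu : r - p ≠ 0 := sub_ne_zero.2 hpr.symm
  have normalized (j : ℕ) (hj₀ : j ≠ 0) (hj : j < 3) :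
      c q • ((q - p) / (r - p)) ^ j + c r • 1 + c s • ((s - p) / (r - p)) ^ j = 0 := by
    have hdeg : (((X - C p) * C (r - p)⁻¹) ^ j).degree < ((3 : ℕ) : WithBot ℕ) := by
      rw [degree_pow, degree_mul, degree_X_sub_C, degree_C (inv_ne_zero hu)]
      simpa using hj
    have key := sum_smul_eval_eq_zero hpow hdeg
    rw [sum_insert (by simp [hpq, hpr, hps]), sum_insert (by simp [hqr, hqs]), sum_pair hrs]
      at key
    simpa [← div_eq_mul_inv, hu, hj₀, add_assoc] using key
  have h₁ := normalized 1 one_ne_zero (by norm_num)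
  have h₂ := normalized 2 two_ne_zero (by norm_num)
  rw [pow_one, pow_one] at h₁
  obtain ⟨x, hx⟩ := mem_range_algebraMap_of_power_sums hL h2 (hc q (by simp)) (hc r (by simp))
    h₁ h₂
  obtain ⟨y, hy⟩ := mem_range_algebraMap_of_power_sums hL h2 (hc s (by simp)) (hc r (by simp))
    (x := (s - p) / (r - p)) (d := c q) (y := (q - p) / (r - p))
    (by linear_combination (norm := module) h₁) (by linear_combination (norm := module) h₂)
  rw [eq_div_iff hu, ← Algebra.smul_def] at hx hy
  refine (collinear_iff_exists_forall_eq_smul_vadd _).2 ⟨p, r - p, fun t ht => ?_⟩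
  simp only [coe_insert, coe_singleton, Set.mem_insert_iff, Set.mem_singleton_iff] at ht
  rcases ht with rfl | rfl | rfl | rfl
  · exact ⟨0, by simp⟩
  · exact ⟨x, by simp [hx]⟩
  · exact ⟨1, by simp⟩
  · exact ⟨y, by simp [hy]⟩

theorem affineIndependentUpTo_normCurve (hL : Module.finrank K L = 3) (h2 : (2 : K) ≠ 0) :
    AffineIndependentUpTo K 4 fun t : L => (t, t ^ 2, Algebra.norm K t) := by
  classical
  intro T hT
  have : FiniteDimensional K L := Module.finite_of_finrank_pos (by lia)
  refine (affineIndependent_finset_iff (f := fun t : L => (t, t ^ 2, Algebra.norm K t))).2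
    fun c hc hcf => ?_
  by_contra! hne
  obtain ⟨t, ht, hct⟩ := hne
  set S := T.filter (c · ≠ 0)
  have hcS : ∀ t ∈ S, c t ≠ 0 := fun t ht => (mem_filter.1 ht).2
  simp only [Prod.ext_iff, Prod.fst_sum, Prod.snd_sum, Prod.smul_fst, Prod.smul_snd,
    Prod.fst_zero, Prod.snd_zero] at hcf
  have hpow : ∀ j < 3, ∑ t ∈ S, c t • t ^ j = 0 := by
    intro j hj
    rw [sum_filter_ne_zero_smul]
    interval_cases j
    · simp [← sum_smul, hc]
    · simpa using hcf.1
    · exact hcf.2.1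
  have hS4 : #S ≤ 4 := (card_filter_le _ _).trans hT
  refine hct ?_
  rcases hS4.lt_or_eq with hlt | heq
  · exact eq_zero_of_sum_smul_pow_eq_zero (x := id) (Set.injOn_id _)
      (fun j hj => hpow j (by lia)) t (mem_filter.2 ⟨ht, hct⟩)
  · have hcol := collinear_of_power_sums (hL ▸ by decide) h2 heq hcS hpow
    exact eq_zero_of_collinear_of_sum_smul_norm_eq_zero (by lia) hcol (by rwa [hL])
      ((sum_filter_ne_zero_smul _).trans hcf.2.2) t (mem_filter.2 ⟨ht, hct⟩)

end NormCurve

section Torus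

variable {K F : Type*} [Field F]

section CommRing

variable [CommRing K] [Algebra K F] (φ : F →ₐ[K] F)

/-- The torus on which the endomorphism `φ` satisfies `φ ^ 2 - φ + 1 = 0`, written additively. Its
points are the directions of the construction without Berge `5`-cycles. -/
def torus : Subgroup Fˣ where
  carrier := {x | φ (φ x) * x = φ x}
  mul_mem' {x y} hx hy := by
    simp only [Set.mem_ofPred_eq, Units.val_mul, map_mul] at hx hy ⊢
    rw [mul_mul_mul_comm, hx, hy]
  one_mem' := by simp
  inv_mem' {x} hx := by
    simp only [Set.mem_ofPred_eq, Units.val_inv_eq_inv_val, map_inv₀, ← mul_inv] at hx ⊢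
    rw [hx]

/-- The equation, in `x`, of the line through `(p, φ p)` and `(q, φ q)` in the plane over `F`
in which points `x` are represented as `(x, φ x)`. -/
def chord (p q x : F) : F :=
  (φ x - φ p) * (q - p) - (φ q - φ p) * (x - p)

variable {φ}

theorem map_map_of_mem_torus {x : Fˣ} (hx : x ∈ torus φ) : φ (φ x) = φ x / x :=
  eq_div_of_mul_eq x.ne_zero hx

@[simp]
theorem chord_left (p q : F) : chord φ p q p = 0 := by
  simp [chord]

@[simp]
theorem chord_right (p q : F) : chord φ p q q = 0 := by
  simp [chord, mul_comm]

theorem chord_mul_left (t p q x : F) :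
    chord φ (t * p) (t * q) (t * x) = t * φ t * chord φ p q x := by
  simp only [chord, map_mul]
  ring

-- If `1`, `y`, `z` were collinear with slope `μ`, applying `φ` would determine `y` and `z` by `μ`.
theorem chord_one_ne_zero {y z : Fˣ} (hy : y ∈ torus φ) (hz : z ∈ torus φ) (hy₁ : y ≠ 1)
    (hz₁ : z ≠ 1) (hyz : y ≠ z) : chord φ 1 y z ≠ 0 := by
  intro hchord
  have sub_one_ne_zero {x : Fˣ} (hx : x ≠ 1) : (x : F) - 1 ≠ 0 :=
    sub_ne_zero.2 (Units.val_eq_one.not.2 hx)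
  set μ : F := (φ y - 1) / (y - 1) with hμ
  have slope_y : φ y - 1 = μ * (y - 1) := (div_mul_cancel₀ _ (sub_one_ne_zero hy₁)).symm
  have slope_z : φ z - 1 = μ * (z - 1) := by
    rw [hμ, div_mul_eq_mul_div, eq_div_iff (sub_one_ne_zero hy₁)]
    simpa [chord, sub_eq_zero] using hchord
  have slope_sub_one {x : Fˣ} (hx : x ∈ torus φ) (hx₁ : x ≠ 1) (h : φ x - 1 = μ * (x - 1)) :
      μ - 1 = φ μ * μ * x := by
    have torus_eq : φ (φ x) * x = φ x := hx
    have h' := congrArg φ h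
    simp only [map_mul, map_sub, map_one] at h'
    refine mul_right_cancel₀ (sub_one_ne_zero hx₁) ?_
    linear_combination (φ μ * x - 1) * h + x * h' - torus_eq
  have mul_sub_eq_zero : φ μ * μ * (y - z : F) = 0 := by
    linear_combination slope_sub_one hz hz₁ slope_z - slope_sub_one hy hy₁ slope_y
  have μ_eq_one : μ - 1 = 0 := by
    rw [slope_sub_one hy hy₁ slope_y, (mul_eq_zero.1 mul_sub_eq_zero).resolve_right
      (sub_ne_zero.2 (Units.val_injective.ne hyz)), zero_mul]
  have fixed : φ y = y := by linear_combination slope_y + (y - 1 : F) * μ_eq_one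
  have key := map_map_of_mem_torus hy
  rw [fixed, fixed, div_self y.ne_zero] at key
  exact hy₁ (Units.val_eq_one.1 key)

theorem chord_ne_zero {x y z : Fˣ} (hx : x ∈ torus φ) (hy : y ∈ torus φ) (hz : z ∈ torus φ)
    (hxy : x ≠ y) (hxz : x ≠ z) (hyz : y ≠ z) : chord φ x y z ≠ 0 := by
  have key := chord_one_ne_zero (mul_mem (inv_mem hx) hy) (mul_mem (inv_mem hx) hz)
    (by rwa [Ne, inv_mul_eq_one]) (by rwa [Ne, inv_mul_eq_one]) ((mul_right_injective _).ne hyz)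
  have scaled := chord_mul_left (φ := φ) x 1 (x⁻¹ * y : Fˣ) (x⁻¹ * z : Fˣ)
  simp only [mul_one, ← Units.val_mul, mul_inv_cancel_left] at scaled
  rw [scaled]
  exact mul_ne_zero (mul_ne_zero x.ne_zero ((map_ne_zero φ).2 x.ne_zero)) key

theorem sum_smul_map_eq_zero {ι : Type*} {T : Finset ι} {c : ι → K} {x : ι → F}
    (h : ∑ i ∈ T, c i • x i = 0) : ∑ i ∈ T, c i • φ (x i) = 0 := by
  simpa using congrArg φ h

-- On the torus, each term of the expanded product is up to a scalar `1` or a conjugate of `x`: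
-- the orbit of `x` under `φ` is `x`, `φ x`, `φ x / x`, `x⁻¹`, `(φ x)⁻¹`, `x / φ x`.
theorem sum_smul_linear_mul_linear_inv_eq_zero {T : Finset (torus φ)} {c : torus φ → K}
    (hc : ∑ x ∈ T, c x = 0) (hcx : ∑ x ∈ T, c x • ((x : Fˣ) : F) = 0) (α β γ α' β' γ' : F) :
    ∑ x ∈ T, c x • ((α + β * (x : Fˣ) + γ * φ (x : Fˣ)) *
      (α' + β' * ((x : Fˣ) : F)⁻¹ + γ' * (φ (x : Fˣ))⁻¹)) = 0 := by
  have h₀ : ∑ x ∈ T, c x • (1 : F) = 0 := by rw [← sum_smul, hc, zero_smul]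
  have h₁ := sum_smul_map_eq_zero (φ := φ) hcx
  have h₂ := sum_smul_map_eq_zero (φ := φ) h₁
  have h₃ := sum_smul_map_eq_zero (φ := φ) h₂
  have h₄ := sum_smul_map_eq_zero (φ := φ) h₃
  have h₅ := sum_smul_map_eq_zero (φ := φ) h₄
  have expand : ∀ x ∈ T, c x • ((α + β * (x : Fˣ) + γ * φ (x : Fˣ)) *
      (α' + β' * ((x : Fˣ) : F)⁻¹ + γ' * (φ (x : Fˣ))⁻¹)) =
      (α * α' + β * β' + γ * γ') * c x • 1 + β * α' * c x • (x : Fˣ) +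
        γ * α' * c x • φ (x : Fˣ) + γ * β' * c x • φ (φ (x : Fˣ)) +
        α * β' * c x • φ (φ (φ (x : Fˣ))) + α * γ' * c x • φ (φ (φ (φ (x : Fˣ)))) +
        β * γ' * c x • φ (φ (φ (φ (φ (x : Fˣ))))) := by
    rintro ⟨x, hx⟩ -
    have hx₀ : (x : F) ≠ 0 := x.ne_zero
    have hφx₀ : φ x ≠ 0 := (map_ne_zero φ).2 hx₀
    simp only [map_map_of_mem_torus hx, map_div₀, Algebra.smul_def]
    field_simp
    ring
  simp only [sum_congr rfl expand, sum_add_distrib, ← mul_sum, h₀, hcx, h₁, h₂, h₃, h₄, h₅,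
    mul_zero, add_zero]

theorem sum_smul_chord_mul_chord_inv_eq_zero {T : Finset (torus φ)} {c : torus φ → K}
    (hc : ∑ x ∈ T, c x = 0) (hcx : ∑ x ∈ T, c x • ((x : Fˣ) : F) = 0) (p q r s : F) :
    ∑ x ∈ T, c x • (chord φ p q (x : Fˣ) * chord φ r s ((x : Fˣ) : F)⁻¹) = 0 := by
  rw [← sum_smul_linear_mul_linear_inv_eq_zero hc hcx
    ((φ q - φ p) * p - φ p * (q - p)) (φ p - φ q) (q - p)
    ((φ s - φ r) * r - φ r * (s - r)) (φ r - φ s) (s - r)]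
  refine sum_congr rfl fun x _ => ?_
  simp only [chord, map_inv₀]
  ring_nf

end CommRing

variable [Field K] [Algebra K F] {φ : F →ₐ[K] F}

-- A product of two chords, the second one in the inverses, vanishes at four of the five points.
theorem affineIndependentUpTo_torus [Finite (torus φ)] (hcard : 5 ≤ Nat.card (torus φ)) :
    AffineIndependentUpTo K 5 fun x : torus φ => ((x : Fˣ) : F) := by
  classical
  refine affineIndependentUpTo_of_card_eq hcard fun T hT => ?_
  refine (affineIndependent_finset_iff (f := fun x : torus φ => ((x : Fˣ) : F))).2
    fun c hc hcx m hm => ?_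
  obtain ⟨p, q, r, s, hpq, -, -, -, -, hrs, others⟩ := card_eq_four.1
    (show #(T.erase m) = 4 by rw [card_erase_of_mem hm, hT])
  have ne_m (x) (hx : x ∈ ({p, q, r, s} : Finset (torus φ))) : (x : Fˣ) ≠ m :=
    Subtype.val_injective.ne (ne_of_mem_erase (others ▸ hx))
  have key := sum_smul_chord_mul_chord_inv_eq_zero hc hcx (p : Fˣ) (q : Fˣ) (r⁻¹ : Fˣ) (s⁻¹ : Fˣ)
  rw [sum_eq_single_of_mem m hm] at key
  · refine (smul_eq_zero.1 key).resolve_right (mul_ne_zero ?_ ?_)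
    · exact chord_ne_zero p.2 q.2 m.2 (Subtype.val_injective.ne hpq) (ne_m p (by simp))
        (ne_m q (by simp))
    · rw [← Units.val_inv_eq_inv_val]
      exact chord_ne_zero (inv_mem r.2) (inv_mem s.2) (inv_mem m.2)
        (inv_injective.ne (Subtype.val_injective.ne hrs)) (inv_injective.ne (ne_m r (by simp)))
        (inv_injective.ne (ne_m s (by simp)))
  · intro x hx hxm
    have hx' : x ∈ ({p, q, r, s} : Finset (torus φ)) := others ▸ mem_erase.2 ⟨hxm, hx⟩
    simp only [mem_insert, mem_singleton] at hx'
    rcases hx' with rfl | rfl | rfl | rfl <;> simp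

theorem natCard_torus_frobenius [Fintype K] [Finite F] (hF : Module.finrank K F = 6) :
    Nat.card (torus (FiniteField.frobeniusAlgHom K F)) + Nat.card K = Nat.card K ^ 2 + 1 := by
  set q := Nat.card K with hq
  obtain ⟨n, hn⟩ : ∃ n, n + q = q ^ 2 + 1 :=
    ⟨q ^ 2 + 1 - q, by have := Nat.le_self_pow two_ne_zero q; lia⟩
  have torus_eq : torus (FiniteField.frobeniusAlgHom K F) = (powMonoidHom n : Fˣ →* Fˣ).ker := by
    ext x
    calc x ∈ torus (FiniteField.frobeniusAlgHom K F)
        ↔ ((x : F) ^ q) ^ q * x = (x : F) ^ q := by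
          rw [hq, Nat.card_eq_fintype_card]
          rfl
      _ ↔ x ^ n * x ^ q = x ^ q := by
          rw [← pow_add, hn, pow_succ, pow_two, pow_mul]
          norm_cast
      _ ↔ x ∈ (powMonoidHom n : Fˣ →* Fˣ).ker := by simp [MonoidHom.mem_ker]
  have dvd : n ∣ Nat.card Fˣ := by
    rw [Nat.card_units, Module.natCard_eq_pow_finrank (K := K), hF, ← hq]
    have : 0 < q := Nat.card_pos
    zify [Nat.one_le_pow 6 q this] at hn ⊢
    exact ⟨((q : ℤ) ^ 3 - 1) * (q + 1), by rw [eq_sub_of_add_eq hn]; ring⟩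
  rw [torus_eq, IsCyclic.card_powMonoidHom_ker, Nat.gcd_eq_right dvd, hn]

end Torus
section FiniteField

variable {K : Type*} [Field K] [Finite K] {r N : ℕ} {a : Fin r → K}

theorem natCard_pow_ten_le_exBerge (h2 : (2 : K) ≠ 0) (hr : 2 ≤ r) (ha : IsSidon a)
    (hN : r * Nat.card K ^ 7 ≤ N) : Nat.card K ^ 10 ≤ exBerge r N 5 := by
  obtain ⟨p, _⟩ := CharP.exists K
  have : Fact p.Prime := ⟨CharP.char_is_prime K p⟩
  let L := FiniteField.Extension K p 3
  have : Finite L := Module.finite_of_finite K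
  have card_L : Nat.card L = Nat.card K ^ 3 := FiniteField.natCard_extension K p 3
  have card_G : Nat.card (L × L × K) = Nat.card K ^ 7 := by
    rw [Nat.card_prod, Nat.card_prod, card_L]
    ring
  have curve := affineIndependentUpTo_normCurve (FiniteField.finrank_extension K p 3) h2
  calc Nat.card K ^ 10 = Nat.card (L × L × K) * Nat.card L := by
        rw [card_G, card_L]
        ring
    _ ≤ exBerge r N 5 := natCard_mul_natCard_le_exBerge hr (by norm_num) (by norm_num) ha curve
        (by rwa [card_G])

theorem natCard_pow_eight_le_two_mul_exBerge (hK : 3 ≤ Nat.card K) (hr : 2 ≤ r) (ha : IsSidon a)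
    (hN : r * Nat.card K ^ 6 ≤ N) : Nat.card K ^ 8 ≤ 2 * exBerge r N 6 := by
  cases nonempty_fintype K
  obtain ⟨p, _⟩ := CharP.exists K
  have : Fact p.Prime := ⟨CharP.char_is_prime K p⟩
  let F := FiniteField.Extension K p 6
  have : Finite F := Module.finite_of_finite K
  let U := torus (FiniteField.frobeniusAlgHom K F)
  have card_F : Nat.card F = Nat.card K ^ 6 := FiniteField.natCard_extension K p 6
  have card_U : Nat.card U + Nat.card K = Nat.card K ^ 2 + 1 :=
    natCard_torus_frobenius (FiniteField.finrank_extension K p 6)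
  have five_le : 5 ≤ Nat.card U := by nlinarith
  have sq_le : Nat.card K ^ 2 ≤ 2 * Nat.card U := by nlinarith
  have lines : Nat.card F * Nat.card U ≤ exBerge r N 6 :=
    natCard_mul_natCard_le_exBerge hr (by norm_num) le_rfl ha (affineIndependentUpTo_torus five_le)
      (by rwa [card_F])
  calc Nat.card K ^ 8 = Nat.card K ^ 6 * Nat.card K ^ 2 := by ring
    _ ≤ Nat.card K ^ 6 * (2 * Nat.card U) := by gcongr
    _ = 2 * (Nat.card F * Nat.card U) := by
        rw [card_F]
        ring
    _ ≤ 2 * exBerge r N 6 := by gcongr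

theorem exists_forall_prime_pow_ten_le_exBerge (hr : 2 ≤ r) :
    ∃ M : ℕ, ∀ p N : ℕ, p.Prime → M < p → r * p ^ 7 ≤ N → p ^ 10 ≤ exBerge r N 5 := by
  obtain ⟨M, sidon⟩ := exists_isSidon_zmod r
  refine ⟨max M 2, fun p N hp hMp hN => ?_⟩
  have : Fact p.Prime := ⟨hp⟩
  obtain ⟨a, ha⟩ := sidon p (by lia)
  have h2 : (2 : ZMod p) ≠ 0 := Ring.two_ne_zero (by rw [ZMod.ringChar_zmod_n]; lia)
  simpa using natCard_pow_ten_le_exBerge h2 hr ha (by simpa using hN)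

theorem exists_forall_prime_pow_eight_le_two_mul_exBerge (hr : 2 ≤ r) :
    ∃ M : ℕ, ∀ p N : ℕ, p.Prime → M < p → r * p ^ 6 ≤ N → p ^ 8 ≤ 2 * exBerge r N 6 := by
  obtain ⟨M, sidon⟩ := exists_isSidon_zmod r
  refine ⟨max M 2, fun p N hp hMp hN => ?_⟩
  have : Fact p.Prime := ⟨hp⟩
  obtain ⟨a, ha⟩ := sidon p (by lia)
  have three_le : 3 ≤ Nat.card (ZMod p) := by
    rw [Nat.card_zmod]
    lia
  simpa using natCard_pow_eight_le_two_mul_exBerge three_le hr ha (by simpa using hN)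

end FiniteField

section Interpolation

theorem exists_prime_le_and_lt_two_mul {x : ℝ} (hx : 2 ≤ x) :
    ∃ p : ℕ, p.Prime ∧ p ≤ x ∧ x < 2 * p := by
  have hx' : 1 ≤ x / 2 := by linarith
  obtain ⟨p, hp, hlt, hle⟩ :=
    Nat.exists_prime_lt_and_le_two_mul ⌊x / 2⌋₊ (Nat.floor_pos.2 hx').ne'
  refine ⟨p, hp, ?_, ?_⟩
  · calc (p : ℝ) ≤ 2 * ⌊x / 2⌋₊ := by exact_mod_cast hle
      _ ≤ 2 * (x / 2) := by
        gcongr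
        exact Nat.floor_le (by positivity)
      _ = x := by ring
  · linarith [(Nat.floor_lt (by positivity)).1 hlt]

theorem exists_pos_forall_mul_pow_le {C : ℝ} (hC : 0 < C) (M e : ℕ) :
    ∃ c > 0, ∀ x y : ℝ, 0 ≤ x → 1 ≤ y →
      (∀ p : ℕ, p.Prime → M < p → p ≤ x → C * p ^ e ≤ y) → c * x ^ e ≤ y := by
  refine ⟨min (C / 2 ^ e) (1 / (2 * (M + 1)) ^ e), by positivity, fun x y hx hy hprime => ?_⟩
  rcases le_or_gt (2 * (M + 1) : ℝ) x with hlarge | hsmall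
  · obtain ⟨p, hp, hpx, hxp⟩ := exists_prime_le_and_lt_two_mul
      (show 2 ≤ x by linarith [Nat.cast_nonneg (α := ℝ) M])
    have hMp : M < p := by
      have : (M : ℝ) < p := by linarith
      exact_mod_cast this
    calc min (C / 2 ^ e) (1 / (2 * (M + 1)) ^ e) * x ^ e
        ≤ C / 2 ^ e * (2 * p) ^ e := by
          gcongr
          exact min_le_left _ _
      _ = C * p ^ e := by
          rw [mul_pow]
          field_simp
      _ ≤ y := hprime p hp hMp hpx
  · calc min (C / 2 ^ e) (1 / (2 * (M + 1)) ^ e) * x ^ e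
        ≤ 1 / (2 * (M + 1)) ^ e * (2 * (M + 1)) ^ e := by
          gcongr
          exact min_le_right _ _
      _ = 1 := one_div_mul_cancel (by positivity)
      _ ≤ y := hy

theorem exists_pos_forall_mul_rpow_le {r k e : ℕ} (hr : 0 < r) (hk : k ≠ 0) {C : ℝ} (hC : 0 < C)
    (M : ℕ) {f : ℕ → ℝ} (hf : ∀ N, r ≤ N → 1 ≤ f N)
    (hprime : ∀ p N : ℕ, p.Prime → M < p → r * p ^ k ≤ N → C * p ^ e ≤ f N) :
    ∃ c : ℝ, 0 < c ∧ ∀ N : ℕ, r ≤ N → c * (N : ℝ) ^ (e / k : ℝ) ≤ f N := by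
  obtain ⟨c, hc, hcf⟩ := exists_pos_forall_mul_pow_le hC M e
  have hr₀ : (0 : ℝ) < r := by exact_mod_cast hr
  refine ⟨c / (r : ℝ) ^ (e / k : ℝ), by positivity, fun N hN => ?_⟩
  set x : ℝ := (N / r : ℝ) ^ (k⁻¹ : ℝ)
  have x_pow : r * x ^ k = N := by
    rw [Real.rpow_inv_natCast_pow (by positivity) hk, mul_div_cancel₀ _ hr₀.ne']
  have rpow_eq : (N : ℝ) ^ (e / k : ℝ) = (r : ℝ) ^ (e / k : ℝ) * x ^ e := by
    rw [← Real.rpow_mul_natCast (by positivity), ← div_eq_inv_mul,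
      ← Real.mul_rpow hr₀.le (by positivity), mul_div_cancel₀ _ hr₀.ne']
  calc c / (r : ℝ) ^ (e / k : ℝ) * (N : ℝ) ^ (e / k : ℝ) = c * x ^ e := by
        rw [rpow_eq]
        field_simp
    _ ≤ f N := hcf x (f N) (by positivity) (hf N hN) fun p hp hMp hpx => hprime p N hp hMp ?_
  have : (r * p ^ k : ℝ) ≤ N := by
    rw [← x_pow]
    gcongr
  exact_mod_cast this

end Interpolation
end BergeTuran

theorem theorem2 (r : ℕ) (hr : 2 ≤ r) :
    (∃ c : ℝ, 0 < c ∧ ∀ N : ℕ, r ≤ N →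
      c * (N : ℝ) ^ (10 / 7 : ℝ) ≤ (BergeTuran.exBerge r N 5 : ℝ)) ∧
    (∃ c' : ℝ, 0 < c' ∧ ∀ N : ℕ, r ≤ N →
      c' * (N : ℝ) ^ (4 / 3 : ℝ) ≤ (BergeTuran.exBerge r N 6 : ℝ)) := by
  have one_le (g N : ℕ) (hN : r ≤ N) : (1 : ℝ) ≤ BergeTuran.exBerge r N g := by
    exact_mod_cast BergeTuran.one_le_exBerge hN g
  constructor
  · obtain ⟨M, hM⟩ := BergeTuran.exists_forall_prime_pow_ten_le_exBerge hr
    have := BergeTuran.exists_pos_forall_mul_rpow_le (k := 7) (e := 10) (by lia) (by norm_num)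
      one_pos M (one_le 5) fun p N hp hMp hN => by
        rw [one_mul]
        exact_mod_cast hM p N hp hMp hN
    exact_mod_cast this
  · obtain ⟨M, hM⟩ := BergeTuran.exists_forall_prime_pow_eight_le_two_mul_exBerge hr
    have := BergeTuran.exists_pos_forall_mul_rpow_le (k := 6) (e := 8) (by lia) (by norm_num)
      one_half_pos M (one_le 6) fun p N hp hMp hN => by
        rw [one_div, inv_mul_le_iff₀ two_pos]
        exact_mod_cast hM p N hp hMp hN
    norm_num at this ⊢
    exact this
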